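/- For $n\ge 1$ let $C(S^1)^{(n)}\subset M_n(\mathbb C)$ be the space of Toeplitz matrices, i.e. of the matrices that are constant along each descending diagonal. A state on $C(S^1)^{(n)}$ is a linear functional $\varphi$ with $\varphi(I)=1$ and $\varphi(T)\ge 0$ for every positive semidefinite Toeplitz matrix $T$; a pure state is an extreme point of the set of states. Let $D_n=\operatorname{diag}(1,\dots,n)$ and equip the states with the Connes distance \[ d_n(\varphi,\psi)=\sup\{|\varphi(T)-\psi(T)| : T\in C(S^1)^{(n)},\ \|[D_n,T]\|\le 1\}, \] where $\|\cdot\|$ is the operator norm. For a continuous function $g$ on $S^1=\mathbb R/2\pi\mathbb Z$ let $P_ngP_n$ be the Toeplitz matrix $(\hat g(i-j))_{1\le i,j\le n}$ of Fourier coefficients of $g$. For $\theta\in S^1$ let \[ f_n^\theta(x)=\sum_{|k|\le n-1}\Bigl(1-\frac{|k|}{n}\Bigr)e^{ik(\theta-x)} \] be the rotated Fejér kernel, and let $\tau_{f_n^\theta}$ be the state on $C(S^1)^{(n)}$ determined by $\tau_{f_n^\theta}(P_ngP_n)=\frac1{2\pi}\int_{S^1} g(x)\,f_n^\theta(x)\,dx$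 for all continuous $g:S^1\to\mathbb C$. Put $\mathcal F_n=\{\tau_{f_n^\theta}:\theta\in S^1\}$. Let $d$ be the arc-length metric on $S^1$. Then every element of $\mathcal F_n$ is a pure state; the metric $d$ is the Connes distance of the circle, i.e. $d(s,t)=\sup\{|g(s)-g(t)| : g\in C^\infty(S^1),\ \|g'\|_\infty\le 1\}$ for all $s,t\in S^1$; and the metric spaces $(\mathcal F_n,d_n)$ converge to $(S^1,d)$ in the Gromov–Hausdorff sense, that is, $\lim_{n\to\infty} d_{GH}(\mathcal F_n,S^1)=0$. -/

import Mathlib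

open Filter Topology Matrix
open scoped Real ComplexOrder ContDiff

namespace ToeplitzCircle

instance factTwoPiPos : Fact (0 < 2 * π) := ⟨Real.two_pi_pos⟩

/-- The circle `ℝ / 2πℤ`. The metric that Mathlib puts on it is the arc-length metric
`dist s t = min_k |s - t + 2πk|`, and `AddCircle.haarAddCircle` is normalised to mass one. -/
abbrev S1 : Type := AddCircle (2 * π)

/-- The Toeplitz operator system: complex `n × n` matrices that are constant along each
descending diagonal. -/
def toeplitz (n : ℕ) : Submodule ℂ (Matrix (Fin n) (Fin n) ℂ) where
  carrier := {T | ∀ i j k l : Fin n, (i : ℤ) - j = (k : ℤ) - l → T i j = T k l}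
  add_mem' {S T} hS hT i j k l h := by
    rw [Matrix.add_apply, Matrix.add_apply, hS i j k l h, hT i j k l h]
  zero_mem' _ _ _ _ _ := rfl
  smul_mem' c T hT i j k l h := by
    rw [Matrix.smul_apply, Matrix.smul_apply, hT i j k l h]

/-- The identity matrix as an element of the Toeplitz system. -/
def toeplitzOne (n : ℕ) : toeplitz n :=
  ⟨1, fun i j k l h => by
    rw [Matrix.one_apply, Matrix.one_apply]
    have : i = j ↔ k = l := by
      rw [Fin.ext_iff, Fin.ext_iff]; omega
    simp [this]⟩

/-- The truncation `g ↦ P_n g P_n`, where `P_n` is the projection onto the span of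
`e^{ix}, …, e^{inx}`: the Toeplitz matrix with entries `ĝ(i - j)`. -/
noncomputable def truncation (n : ℕ) (g : C(S1, ℂ)) : toeplitz n :=
  ⟨Matrix.of fun i j => fourierCoeff g ((i : ℤ) - j), fun i j k l h => by
    simp only [Matrix.of_apply, h]⟩

/-- States of the Toeplitz system: the unital positive linear functionals. Here `0 ≤ φ T` in `ℂ`
means that `φ T` is real and nonnegative. -/
def stateSet (n : ℕ) : Set (toeplitz n →ₗ[ℂ] ℂ) :=
  {φ | (∀ T : toeplitz n, (T : Matrix (Fin n) (Fin n) ℂ).PosSemidef → 0 ≤ φ T) ∧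
    φ (toeplitzOne n) = 1}

/-- The state space of the Toeplitz system, as a type. -/
structure ToeplitzState (n : ℕ) where
  toFunctional : toeplitz n →ₗ[ℂ] ℂ
  mem_stateSet : toFunctional ∈ stateSet n

/-- The pure states: the extreme points of the state space. -/
def pureStates (n : ℕ) : Set (ToeplitzState n) :=
  {φ | φ.toFunctional ∈ (stateSet n).extremePoints ℝ}

/-- The truncated Dirac operator `diag (1, …, n)`. -/
def dirac (n : ℕ) : Matrix (Fin n) (Fin n) ℂ :=
  Matrix.diagonal fun i => (i : ℂ) + 1

/-- The operator norm, for the Euclidean norm of `ℂ^n`, of the commutator `[D_n, T]`. -/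
noncomputable def lipNorm {n : ℕ} (T : toeplitz n) : ℝ :=
  ‖Matrix.toEuclideanCLM (n := Fin n) (𝕜 := ℂ) (dirac n * T - T * dirac n)‖

/-- The Connes distance
`d_n(φ, ψ) = sup {|φ(T) - ψ(T)| : T Toeplitz, ‖[D_n, T]‖ ≤ 1}`. -/
noncomputable def connesDist {n : ℕ} (φ ψ : ToeplitzState n) : ℝ :=
  sSup {r : ℝ | ∃ T : toeplitz n, lipNorm T ≤ 1 ∧ r = ‖φ.toFunctional T - ψ.toFunctional T‖}

/-! ### The Connes distance is a metric on the state space -/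

lemma norm_entry_le {n : ℕ} (A : Matrix (Fin n) (Fin n) ℂ) (i j : Fin n) :
    ‖A i j‖ ≤ ‖Matrix.toEuclideanCLM (n := Fin n) (𝕜 := ℂ) A‖ := by
  set L := Matrix.toEuclideanCLM (n := Fin n) (𝕜 := ℂ) A with hL
  have h1 : L (EuclideanSpace.single j 1) i = A i j := by
    rw [hL, Matrix.ofLp_toEuclideanCLM]
    simp
  calc ‖A i j‖ = ‖L (EuclideanSpace.single j 1) i‖ := by rw [h1]
    _ ≤ ‖L (EuclideanSpace.single j 1)‖ := PiLp.norm_apply_le _ i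
    _ ≤ ‖L‖ * ‖EuclideanSpace.single j (1 : ℂ)‖ := L.le_opNorm _
    _ = ‖L‖ := by simp

lemma entry_le_lipNorm {n : ℕ} (T : toeplitz n) {i j : Fin n} (h : i ≠ j) :
    ‖(T : Matrix (Fin n) (Fin n) ℂ) i j‖ ≤ lipNorm T := by
  refine le_trans ?_ (norm_entry_le _ i j)
  have h1 : (dirac n * (T : Matrix (Fin n) (Fin n) ℂ) - T * dirac n) i j
      = (((i : ℤ) - (j : ℤ) : ℤ) : ℂ) * (T : Matrix (Fin n) (Fin n) ℂ) i j := by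
    rw [Matrix.sub_apply, dirac, Matrix.diagonal_mul, Matrix.mul_diagonal]
    push_cast
    ring
  rw [h1, norm_mul, Complex.norm_intCast]
  have h2 : (1 : ℝ) ≤ |(((i : ℤ) - (j : ℤ) : ℤ) : ℝ)| := by
    have : (i : ℤ) - (j : ℤ) ≠ 0 := by
      intro h0; apply h; rw [Fin.ext_iff]; omega
    exact_mod_cast Int.one_le_abs this
  nlinarith [norm_nonneg ((T : Matrix (Fin n) (Fin n) ℂ) i j)]

/-- Toeplitz matrices with `‖[D_n, T]‖ ≤ 1` have entries bounded by one, up to a multiple of the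
identity, on which two states agree. -/
lemma exists_normalized {n : ℕ} (T : toeplitz n) (hT : lipNorm T ≤ 1) :
    ∃ S : toeplitz n, (∀ i j, ‖(S : Matrix (Fin n) (Fin n) ℂ) i j‖ ≤ 1) ∧
      ∀ φ ψ : ToeplitzState n, φ.toFunctional T - ψ.toFunctional T
        = φ.toFunctional S - ψ.toFunctional S := by
  rcases Nat.eq_zero_or_pos n with rfl | hn
  · exact ⟨T, fun i => i.elim0, fun _ _ => rfl⟩
  · set c := (T : Matrix (Fin n) (Fin n) ℂ) ⟨0, hn⟩ ⟨0, hn⟩ with hc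
    refine ⟨T - c • toeplitzOne n, fun i j => ?_, fun φ ψ => ?_⟩
    · by_cases hij : i = j
      · subst hij
        have h0 : (T : Matrix (Fin n) (Fin n) ℂ) i i = c := T.2 i i _ _ (by simp)
        have h1 : ((T - c • toeplitzOne n : toeplitz n) : Matrix (Fin n) (Fin n) ℂ) i i = 0 := by
          simp [toeplitzOne, h0]
        rw [h1]; simp
      · have h1 : ((T - c • toeplitzOne n : toeplitz n) : Matrix (Fin n) (Fin n) ℂ) i j
            = (T : Matrix (Fin n) (Fin n) ℂ) i j := by
          simp [toeplitzOne, hij]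
        rw [h1]
        exact (entry_le_lipNorm T hij).trans hT
    · rw [map_sub, map_sub, map_smul, map_smul, φ.mem_stateSet.2, ψ.mem_stateSet.2]
      ring

/-- A linear functional is bounded on the Toeplitz matrices with entries bounded by one. -/
lemma exists_bound {n : ℕ} (f : toeplitz n →ₗ[ℂ] ℂ) :
    ∃ C : ℝ, ∀ S : toeplitz n, (∀ i j, ‖(S : Matrix (Fin n) (Fin n) ℂ) i j‖ ≤ 1) →
      ‖f S‖ ≤ C := by
  obtain ⟨F, hF⟩ := LinearMap.exists_extend f
  refine ⟨∑ i, ∑ j, ‖F (Matrix.single i j 1)‖, fun S hS => ?_⟩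
  have h1 : f S = F (S : Matrix (Fin n) (Fin n) ℂ) := by rw [← hF]; rfl
  rw [h1, Matrix.matrix_eq_sum_single (S : Matrix (Fin n) (Fin n) ℂ), map_sum]
  refine (norm_sum_le _ _).trans (Finset.sum_le_sum fun i _ => ?_)
  rw [map_sum]
  refine (norm_sum_le _ _).trans (Finset.sum_le_sum fun j _ => ?_)
  have h2 : Matrix.single i j ((S : Matrix (Fin n) (Fin n) ℂ) i j)
      = (S : Matrix (Fin n) (Fin n) ℂ) i j • Matrix.single i j (1 : ℂ) := by
    rw [Matrix.smul_single]; simp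
  rw [h2, map_smul, norm_smul]
  exact mul_le_of_le_one_left (norm_nonneg _) (hS i j)

lemma bddAbove_connesDist {n : ℕ} (φ ψ : ToeplitzState n) :
    BddAbove {r : ℝ | ∃ T : toeplitz n,
      lipNorm T ≤ 1 ∧ r = ‖φ.toFunctional T - ψ.toFunctional T‖} := by
  obtain ⟨C, hC⟩ := exists_bound (φ.toFunctional - ψ.toFunctional)
  refine ⟨C, ?_⟩
  rintro r ⟨T, hT, rfl⟩
  obtain ⟨S, hS, hST⟩ := exists_normalized T hT
  rw [hST φ ψ]
  exact hC S hS

lemma lipNorm_zero {n : ℕ} : lipNorm (0 : toeplitz n) = 0 := by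
  simp [lipNorm]

lemma lipNorm_smul {n : ℕ} (c : ℂ) (T : toeplitz n) : lipNorm (c • T) = ‖c‖ * lipNorm T := by
  have : dirac n * ((c • T : toeplitz n) : Matrix (Fin n) (Fin n) ℂ)
      - ((c • T : toeplitz n) : Matrix (Fin n) (Fin n) ℂ) * dirac n
      = c • (dirac n * (T : Matrix (Fin n) (Fin n) ℂ) - T * dirac n) := by
    rw [Submodule.coe_smul, Matrix.mul_smul, Matrix.smul_mul, smul_sub]
  rw [lipNorm, this, map_smul, norm_smul, lipNorm]

lemma le_connesDist {n : ℕ} (φ ψ : ToeplitzState n) {T : toeplitz n} (hT : lipNorm T ≤ 1) :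
    ‖φ.toFunctional T - ψ.toFunctional T‖ ≤ connesDist φ ψ :=
  le_csSup (bddAbove_connesDist φ ψ) ⟨T, hT, rfl⟩

lemma connesDist_le {n : ℕ} (φ ψ : ToeplitzState n) {C : ℝ}
    (h : ∀ T : toeplitz n, lipNorm T ≤ 1 → ‖φ.toFunctional T - ψ.toFunctional T‖ ≤ C) :
    connesDist φ ψ ≤ C := by
  refine csSup_le ⟨_, 0, ?_, rfl⟩ ?_
  · rw [lipNorm_zero]; exact zero_le_one
  · rintro r ⟨T, hT, rfl⟩
    exact h T hT

lemma eq_of_connesDist_eq_zero {n : ℕ} {φ ψ : ToeplitzState n} (h : connesDist φ ψ = 0) :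
    φ = ψ := by
  suffices H : φ.toFunctional = ψ.toFunctional by
    cases φ; cases ψ; cases H; rfl
  refine LinearMap.ext fun T => ?_
  set c : ℂ := ((1 + lipNorm T : ℝ) : ℂ)⁻¹ with hc
  have hpos : 0 < 1 + lipNorm T := by
    have : 0 ≤ lipNorm T := norm_nonneg _
    linarith
  have hc0 : c ≠ 0 := by
    rw [hc]; exact inv_ne_zero (by exact_mod_cast hpos.ne')
  have h1 : lipNorm (c • T) ≤ 1 := by
    rw [lipNorm_smul, hc, norm_inv, Complex.norm_real, Real.norm_of_nonneg hpos.le,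
      inv_mul_le_iff₀ hpos]
    linarith
  have h2 := le_connesDist φ ψ h1
  rw [h, map_smul, map_smul, ← smul_sub, norm_smul] at h2
  have h3 : ‖φ.toFunctional T - ψ.toFunctional T‖ = 0 := by
    have := norm_pos_iff.2 hc0
    nlinarith [norm_nonneg (φ.toFunctional T - ψ.toFunctional T)]
  exact sub_eq_zero.1 (norm_eq_zero.1 h3)

/-- The state space of the Toeplitz system with the Connes distance `d_n` as its distance. -/
noncomputable instance instMetricSpaceToeplitzState (n : ℕ) : MetricSpace (ToeplitzState n) where
  dist φ ψ := connesDist φ ψ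
  dist_self φ := by
    refine le_antisymm (connesDist_le _ _ fun T _ => by simp) ?_
    exact (norm_nonneg _).trans (le_connesDist φ φ (T := 0) (by rw [lipNorm_zero]; exact zero_le_one))
  dist_comm φ ψ := by
    simp only [connesDist, norm_sub_rev]
  dist_triangle φ ψ χ := by
    refine connesDist_le _ _ fun T hT => ?_
    exact (norm_sub_le_norm_sub_add_norm_sub _ _ _).trans
      (add_le_add (le_connesDist φ ψ hT) (le_connesDist ψ χ hT))
  eq_of_dist_eq_zero h := eq_of_connesDist_eq_zero h

/-! ### The Fejér states -/

/-- The functional `τ` is given by the density `f` with respect to the normalised Haar measure of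
the circle: `τ (P_n g P_n) = ∫ g f` for all continuous `g`. As every Toeplitz matrix is of the form
`P_n g P_n`, there is at most one such `τ`. -/
def HasDensity {n : ℕ} (τ : ToeplitzState n) (f : S1 → ℂ) : Prop :=
  ∀ g : C(S1, ℂ), τ.toFunctional (truncation n g)
    = ∫ x, g x * f x ∂AddCircle.haarAddCircle

/-- The Fejér kernel rotated by `e^{iθ}`:
`f_n^θ (x) = ∑_{|k| ≤ n - 1} (1 - |k| / n) e^{ik(θ - x)}`. -/
noncomputable def fejerKernel (n : ℕ) (θ x : S1) : ℂ :=
  ∑ k ∈ Finset.Ioo (-(n : ℤ)) n, (1 - ((|k| : ℤ) : ℂ) / n) * fourier k (θ - x)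

/-- The set `F_n` of the states given by rotated Fejér kernels; as a subset of the state space it
carries the metric `d_n`. -/
def fejerStates (n : ℕ) : Set (ToeplitzState n) :=
  {τ | ∃ θ : S1, HasDensity τ (fejerKernel n θ)}

/-- An explicit formula for the functional with density `fejerKernel n θ`. -/
noncomputable def fejerFunctional (n : ℕ) (θ : S1) : toeplitz n →ₗ[ℂ] ℂ where
  toFun T := (n : ℂ)⁻¹ * ∑ i : Fin n, ∑ j : Fin n,
    fourier ((i : ℤ) - j) θ * (T : Matrix (Fin n) (Fin n) ℂ) i j
  map_add' S T := by
    simp only [Submodule.coe_add, Matrix.add_apply, mul_add, Finset.sum_add_distrib]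
  map_smul' c T := by
    simp only [Submodule.coe_smul, Matrix.smul_apply, smul_eq_mul, RingHom.id_apply,
      Finset.mul_sum]
    refine Finset.sum_congr rfl fun i _ => Finset.sum_congr rfl fun j _ => ?_
    ring

lemma fejerFunctional_mem (n : ℕ) [NeZero n] (θ : S1) : fejerFunctional n θ ∈ stateSet n := by
  constructor
  · intro T hT
    have h1 := hT.dotProduct_mulVec_nonneg (fun j : Fin n => fourier (-(j : ℤ)) θ)
    have h2 : fejerFunctional n θ T = (n : ℂ)⁻¹ *
        (star (fun j : Fin n => fourier (-(j : ℤ)) θ) ⬝ᵥ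
          ((T : Matrix (Fin n) (Fin n) ℂ) *ᵥ fun j : Fin n => fourier (-(j : ℤ)) θ)) := by
      simp only [fejerFunctional, LinearMap.coe_mk, AddHom.coe_mk, dotProduct, Matrix.mulVec,
        Finset.mul_sum]
      refine Finset.sum_congr rfl fun i _ => Finset.sum_congr rfl fun j _ => ?_
      have h3 : star (fourier (-(i : ℤ)) θ : ℂ) = fourier (i : ℤ) θ := by
        rw [fourier_neg]; simp
      rw [Pi.star_apply, h3, sub_eq_add_neg, fourier_add]
      ring
    rw [h2]
    refine mul_nonneg ?_ h1
    simp
  · have hn : (n : ℂ) ≠ 0 := Nat.cast_ne_zero.2 (NeZero.ne n)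
    simp only [fejerFunctional, LinearMap.coe_mk, AddHom.coe_mk, toeplitzOne, Matrix.one_apply,
      mul_ite, mul_one, mul_zero, Finset.sum_ite_eq, Finset.mem_univ, if_true, sub_self,
      fourier_zero, Finset.sum_const, Finset.card_univ, Fintype.card_fin, nsmul_eq_mul]
    field_simp

/-- The state given by the Fejér kernel rotated by `e^{iθ}`. -/
noncomputable def fejerState (n : ℕ) [NeZero n] (θ : S1) : ToeplitzState n :=
  ⟨fejerFunctional n θ, fejerFunctional_mem n θ⟩

lemma card_diagonal (n : ℕ) (k : ℤ) (hk : k ∈ Finset.Ioo (-(n : ℤ)) n) :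
    ((Finset.univ.filter fun p : Fin n × Fin n => (p.1 : ℤ) - p.2 = k).card : ℤ) = n - |k| := by
  rw [Finset.mem_Ioo] at hk
  have h : (Finset.univ.filter fun p : Fin n × Fin n => (p.1 : ℤ) - p.2 = k).card
      = (Finset.range (n - k.natAbs)).card := by
    refine Finset.card_nbij' (fun p => min p.1.1 p.2.1)
      (fun m => if h : m + k.toNat < n ∧ m + (-k).toNat < n then
        (⟨m + k.toNat, h.1⟩, ⟨m + (-k).toNat, h.2⟩)
        else (⟨0, by omega⟩, ⟨0, by omega⟩)) ?_ ?_ ?_ ?_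
    · rintro ⟨i, j⟩ hp
      simp only [Finset.coe_filter, Finset.mem_univ, true_and, Set.mem_ofPred_eq] at hp
      simp only [Finset.coe_range, Set.mem_Iio]
      omega
    · intro m hm
      simp only [Finset.coe_range, Set.mem_Iio] at hm
      have h : m + k.toNat < n ∧ m + (-k).toNat < n := by omega
      simp only [h, and_self, dif_pos, Finset.coe_filter, Finset.mem_univ, true_and,
        Set.mem_ofPred_eq]
      omega
    · rintro ⟨i, j⟩ hp
      simp only [Finset.coe_filter, Finset.mem_univ, true_and, Set.mem_ofPred_eq] at hp
      have h : min i.1 j.1 + k.toNat < n ∧ min i.1 j.1 + (-k).toNat < n := by omega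
      simp only [h, and_self, dif_pos, Prod.mk.injEq, Fin.ext_iff]
      omega
    · intro m hm
      simp only [Finset.coe_range, Set.mem_Iio] at hm
      have h : m + k.toNat < n ∧ m + (-k).toNat < n := by omega
      simp only [h, and_self, dif_pos]
      omega
  rw [h, Finset.card_range, Int.abs_eq_natAbs]
  omega

lemma hasDensity_fejerState (n : ℕ) [NeZero n] (θ : S1) :
    HasDensity (fejerState n θ) (fejerKernel n θ) := by
  intro g
  have hn : (n : ℂ) ≠ 0 := Nat.cast_ne_zero.2 (NeZero.ne n)
  have hint : ∀ k : ℤ, ∫ x, g x * fourier k (θ - x) ∂AddCircle.haarAddCircle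
      = fourier k θ * fourierCoeff g k := by
    intro k
    rw [fourierCoeff, ← MeasureTheory.integral_const_mul]
    refine MeasureTheory.integral_congr_ae (Eventually.of_forall fun x => ?_)
    have : (fourier k (θ - x) : ℂ) = fourier k θ * fourier (-k) x := by
      rw [fourier_apply, fourier_apply, fourier_apply, zsmul_sub, neg_zsmul, sub_eq_add_neg,
        AddCircle.toCircle_add, Circle.coe_mul]
    simp only [this, smul_eq_mul]
    ring
  have hR : ∫ x, g x * fejerKernel n θ x ∂AddCircle.haarAddCircle
      = ∑ k ∈ Finset.Ioo (-(n : ℤ)) n,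
          (1 - ((|k| : ℤ) : ℂ) / n) * (fourier k θ * fourierCoeff g k) := by
    simp only [fejerKernel, Finset.mul_sum]
    rw [MeasureTheory.integral_finsetSum]
    · refine Finset.sum_congr rfl fun k _ => ?_
      rw [← hint k, ← MeasureTheory.integral_const_mul]
      refine MeasureTheory.integral_congr_ae (Eventually.of_forall fun x => ?_)
      simp only []
      ring
    · intro k _
      have hcont : Continuous fun x : S1 =>
          g x * ((1 - ((|k| : ℤ) : ℂ) / n) * fourier k (θ - x)) := by
        fun_prop
      exact hcont.integrable_of_hasCompactSupport (HasCompactSupport.of_compactSpace _)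
  rw [hR]
  change (n : ℂ)⁻¹ * ∑ i : Fin n, ∑ j : Fin n,
    fourier ((i : ℤ) - j) θ * fourierCoeff g ((i : ℤ) - j) = _
  rw [← Finset.sum_product', Finset.univ_product_univ,
    ← Finset.sum_fiberwise_of_maps_to (t := Finset.Ioo (-(n : ℤ)) n)
      (g := fun p : Fin n × Fin n => (p.1 : ℤ) - p.2)
      (fun p _ => by rw [Finset.mem_Ioo]; omega), Finset.mul_sum]
  refine Finset.sum_congr rfl fun k hk => ?_
  rw [Finset.sum_congr rfl (g := fun _ => fourier k θ * fourierCoeff g k) (fun p hp => by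
    rw [(Finset.mem_filter.1 hp).2]), Finset.sum_const, nsmul_eq_mul]
  have hcard : ((Finset.univ.filter fun p : Fin n × Fin n => (p.1 : ℤ) - p.2 = k).card : ℂ)
      = n - ((|k| : ℤ) : ℂ) := by
    exact_mod_cast congrArg (Int.cast : ℤ → ℂ) (card_diagonal n k hk)
  rw [hcard]
  field_simp

/-- Every Toeplitz matrix is a truncation of a continuous function. -/
lemma truncation_surjective (n : ℕ) : Function.Surjective (truncation n) := by
  intro T
  let c : ℤ → ℂ := fun k => if h : k.toNat < n ∧ (-k).toNat < n then
    (T : Matrix (Fin n) (Fin n) ℂ) ⟨k.toNat, h.1⟩ ⟨(-k).toNat, h.2⟩ else 0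
  refine ⟨∑ k ∈ Finset.Ioo (-(n : ℤ)) n, c k • fourier k, Subtype.ext ?_⟩
  ext i j
  change fourierCoeff _ ((i : ℤ) - j) = _
  have h1 : ((∑ k ∈ Finset.Ioo (-(n : ℤ)) n, c k • fourier k : C(S1, ℂ)) : S1 → ℂ)
      = ∑ k ∈ Finset.Ioo (-(n : ℤ)) n, c k • (fourier k : S1 → ℂ) := by
    ext x; simp
  rw [h1, fourierCoeff.sum, Finset.sum_apply]
  · have h2 : ∀ k : ℤ, fourierCoeff (c k • (fourier k : S1 → ℂ)) ((i : ℤ) - j)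
        = if (i : ℤ) - j = k then c k else 0 := by
      intro k
      have := fourierCoeff.const_smul (T := 2 * π) (fourier k : S1 → ℂ) (c k) ((i : ℤ) - j)
      rw [this, fourierCoeff_fourier, Pi.single_apply]
      simp
    rw [Finset.sum_congr rfl fun k _ => h2 k, Finset.sum_ite_eq,
      if_pos (by rw [Finset.mem_Ioo]; omega)]
    have h3 : ((i : ℤ) - j).toNat < n ∧ (-((i : ℤ) - j)).toNat < n := by omega
    simp only [c, dif_pos h3]
    exact T.2 _ _ _ _ (by simp only []; omega)
  · intro k _
    have hcont : Continuous (c k • (fourier k : S1 → ℂ)) := by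
      have := (fourier (T := 2 * π) k).continuous
      fun_prop
    exact hcont.integrable_of_hasCompactSupport (HasCompactSupport.of_compactSpace _)

lemma HasDensity.unique {n : ℕ} {σ τ : ToeplitzState n} {f : S1 → ℂ}
    (hσ : HasDensity σ f) (hτ : HasDensity τ f) : σ = τ := by
  suffices H : σ.toFunctional = τ.toFunctional by
    cases σ; cases τ; cases H; rfl
  refine LinearMap.ext fun T => ?_
  obtain ⟨g, rfl⟩ := truncation_surjective n T
  rw [hσ g, hτ g]

lemma fejerStates_eq_range (n : ℕ) [NeZero n] : fejerStates n = Set.range (fejerState n) := by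
  ext τ
  constructor
  · rintro ⟨θ, hθ⟩
    exact ⟨θ, (hasDensity_fejerState n θ).unique hθ⟩
  · rintro ⟨θ, rfl⟩
    exact ⟨θ, hasDensity_fejerState n θ⟩

lemma dist_fejerState_le (n : ℕ) [NeZero n] (θ η : S1) :
    dist (fejerState n θ) (fejerState n η) ≤ ‖(n : ℂ)⁻¹‖ * ∑ i : Fin n, ∑ j : Fin n,
      ‖(fourier ((i : ℤ) - j) θ - fourier ((i : ℤ) - j) η : ℂ)‖ := by
  refine connesDist_le _ _ fun T hT => ?_
  obtain ⟨S, hS, hST⟩ := exists_normalized T hT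
  rw [hST]
  change ‖(n : ℂ)⁻¹ * _ - (n : ℂ)⁻¹ * _‖ ≤ _
  rw [← mul_sub, norm_mul, ← Finset.sum_sub_distrib]
  refine mul_le_mul_of_nonneg_left ?_ (norm_nonneg _)
  refine (norm_sum_le _ _).trans (Finset.sum_le_sum fun i _ => ?_)
  rw [← Finset.sum_sub_distrib]
  refine (norm_sum_le _ _).trans (Finset.sum_le_sum fun j _ => ?_)
  rw [← sub_mul, norm_mul]
  exact mul_le_of_le_one_right (norm_nonneg _) (hS i j)

lemma continuous_fejerState (n : ℕ) [NeZero n] : Continuous (fejerState n) := by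
  rw [continuous_iff_continuousAt]
  intro η
  rw [ContinuousAt, tendsto_iff_dist_tendsto_zero]
  refine squeeze_zero (fun _ => dist_nonneg) (fun θ => dist_fejerState_le n θ η) ?_
  have hcont : Continuous fun θ : S1 => ‖(n : ℂ)⁻¹‖ * ∑ i : Fin n, ∑ j : Fin n,
      ‖(fourier ((i : ℤ) - j) θ - fourier ((i : ℤ) - j) η : ℂ)‖ := by
    fun_prop
  simpa using hcont.tendsto η

instance instNonemptyFejerStates (n : ℕ) [NeZero n] : Nonempty (fejerStates n) :=
  ⟨⟨fejerState n 0, 0, hasDensity_fejerState n 0⟩⟩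

instance instCompactSpaceFejerStates (n : ℕ) [NeZero n] : CompactSpace (fejerStates n) := by
  rw [← isCompact_iff_compactSpace, fejerStates_eq_range]
  exact isCompact_range (continuous_fejerState n)

end ToeplitzCircle

open ToeplitzCircle

/-! Purity. The Fejér state at `θ` is the vector state of `(e^{-ijθ})_j / √n`. Its value at the rank
one matrix `pointMass n x` is `|∑_{j<n} (wz)^j|² / n`, with `w = e^{iθ}` and `z = e^{ix}`. Up to the
factor `z^{n-1}`, the values of any functional on these matrices are those of a polynomial of degree
at most `2(n-1)`, which determines the functional. If the Fejér state is `aφ + bψ`, positivity gives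
`φ ≤ a⁻¹(aφ + bψ)` on positive matrices, so the polynomial of `φ` is dominated on the circle by
`geomSquare`. All zeros of the latter lie on the circle and its degree is `2(n-1)`, so domination
forces proportionality and `φ(1) = 1` fixes the factor (`eq_fejerFunctional_of_dominated`).

Convergence. The map `θ ↦ fejerState n θ` from the circle onto the Fejér states does not increase
distances, since the `θ`-derivative of the value at `T` is `i` times the value at `[D_n, T]`
(`dist_fejerState_le_dist`). Conversely, `‖g'‖ ≤ 1` gives `‖[D_n, P_n g P_n]‖ ≤ 1`, and the Fejér
states evaluate `P_n g P_n` to the Cesàro means of `g`, which converge uniformly. A single `g`, a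
smoothed triangle wave, serves all pairs of points after translation, so the distortion tends to
zero (`eventually_dist_le`). The same wave shows that the arc length is the Connes distance of the
circle. -/

namespace ToeplitzCircle

/-! ### Divisibility of polynomials dominated on the unit circle -/

-- Induction on the prescribed zeros, with multiplicity. The bound at `a` makes `a` a zero of `Q`;
-- cancelling `X - a` keeps the bound away from `a`, and continuity restores it at `a` because the
-- circle has no isolated points.
open Polynomial in
lemma prod_dvd_of_norm_le (s : Multiset ℂ) (C : ℝ) :
    ∀ Q : ℂ[X], (∀ a ∈ s, ‖a‖ = 1) →
      (∀ z : ℂ, ‖z‖ = 1 → ‖Q.eval z‖ ≤ C * ‖((s.map fun a => X - Polynomial.C a).prod).eval z‖) →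
      (s.map fun a => X - Polynomial.C a).prod ∣ Q := by
  induction s using Multiset.induction_on with
  | empty => intro Q _ _; simp
  | cons a s ih =>
    intro Q hs hQ
    have ha : ‖a‖ = 1 := hs a (Multiset.mem_cons_self a s)
    have hroot : Q.IsRoot a := by
      have := hQ a ha
      simpa [eval_mul] using this
    obtain ⟨R, rfl⟩ := dvd_iff_isRoot.2 hroot
    rw [Multiset.map_cons, Multiset.prod_cons]
    refine mul_dvd_mul_left _ (ih R (fun b hb => hs b (Multiset.mem_cons_of_mem hb)) ?_)
    set P := (s.map fun a => X - Polynomial.C a).prod with hP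
    have hoff : ∀ z : ℂ, ‖z‖ = 1 → z ≠ a → ‖R.eval z‖ ≤ C * ‖P.eval z‖ := by
      intro z hz hza
      have h1 := hQ z hz
      rw [Multiset.map_cons, Multiset.prod_cons, eval_mul, eval_mul, norm_mul, norm_mul] at h1
      have h2 : 0 < ‖(X - Polynomial.C a).eval z‖ := by
        simpa [sub_eq_zero] using hza
      refine le_of_mul_le_mul_left ?_ h2
      linarith
    intro z hz
    by_cases hza : z = a
    · subst hza
      -- A connected set with more than one point has no isolated points.
      have hacc : AccPt z (𝓟 (Metric.sphere (0 : ℂ) 1)) := by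
        refine IsPreconnected.preperfect_of_nontrivial ?_
          (isPreconnected_sphere (by rw [Complex.rank_real_complex]; norm_num) _ _) z (by simpa using hz)
        exact ⟨1, by simp, -1, by simp, by norm_num⟩
      have hmem : z ∈ closure (Metric.sphere (0 : ℂ) 1 \ {z}) :=
        mem_closure_iff_clusterPt.2 (accPt_principal_iff_clusterPt.1 hacc)
      have hclosed : IsClosed {w : ℂ | ‖R.eval w‖ ≤ C * ‖P.eval w‖} :=
        isClosed_le (by fun_prop) (by fun_prop)
      refine hclosed.closure_subset_iff.2 ?_ hmem
      rintro w ⟨hw, hwz⟩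
      exact hoff w (by simpa using hw) hwz
    · exact hoff z hz hza

open Polynomial in
/-- A polynomial that is dominated on the unit circle by a polynomial whose zeros all lie on the
unit circle is divisible by it. -/
lemma dvd_of_norm_le_on_circle {P Q : ℂ[X]} (hP : P ≠ 0) (hroots : ∀ a, P.IsRoot a → ‖a‖ = 1)
    {C : ℝ} (hQ : ∀ z : ℂ, ‖z‖ = 1 → ‖Q.eval z‖ ≤ C * ‖P.eval z‖) : P ∣ Q := by
  have hsplit := (IsAlgClosed.splits P).eq_prod_roots
  have hlead : P.leadingCoeff ≠ 0 := leadingCoeff_ne_zero.2 hP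
  rw [hsplit, IsUnit.mul_left_dvd (isUnit_C.2 hlead.isUnit)]
  refine prod_dvd_of_norm_le _ (C * ‖P.leadingCoeff‖) Q
    (fun a ha => hroots a (isRoot_of_mem_roots ha)) fun z hz => (hQ z hz).trans_eq ?_
  conv_lhs => rw [hsplit, eval_mul, eval_C, norm_mul, ← mul_assoc]

/-! ### Purity of the Fejér states -/

/-- The elements of the standard basis of the Toeplitz system. -/
noncomputable def toeplitzBasis (n : ℕ) (k : ℤ) : toeplitz n := truncation n (fourier k)

lemma toeplitzBasis_apply (n : ℕ) (k : ℤ) (i j : Fin n) :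
    (toeplitzBasis n k : Matrix (Fin n) (Fin n) ℂ) i j = if (i : ℤ) - j = k then 1 else 0 := by
  change fourierCoeff (fourier k : S1 → ℂ) ((i : ℤ) - j) = _
  rw [fourierCoeff_fourier, Pi.single_apply]

lemma eq_sum_toeplitzBasis {n : ℕ} (T : toeplitz n) :
    ∃ c : ℤ → ℂ, T = ∑ k ∈ Finset.Ioo (-(n : ℤ)) n, c k • toeplitzBasis n k := by
  -- The diagonal `k` is read off at row `max k 0` and column `max (-k) 0`, its first entry.
  refine ⟨fun k => if h : k.toNat < n ∧ (-k).toNat < n then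
    (T : Matrix (Fin n) (Fin n) ℂ) ⟨k.toNat, h.1⟩ ⟨(-k).toNat, h.2⟩ else 0, Subtype.ext ?_⟩
  ext i j
  simp only [Submodule.coe_sum, Submodule.coe_smul, Matrix.sum_apply, Matrix.smul_apply,
    toeplitzBasis_apply, smul_eq_mul, mul_ite, mul_one, mul_zero]
  rw [Finset.sum_ite_eq, if_pos (by rw [Finset.mem_Ioo]; omega)]
  have h : ((i : ℤ) - j).toNat < n ∧ (-((i : ℤ) - j)).toNat < n := by omega
  rw [dif_pos h]
  exact T.2 _ _ _ _ (by simp only []; omega)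

/-- The rank one positive Toeplitz matrix `(z^{i - j})` at the point `z = e^{ix}`. -/
noncomputable def pointMass (n : ℕ) (x : S1) : toeplitz n :=
  ⟨Matrix.of fun i j => fourier ((i : ℤ) - j) x, fun i j k l h => by
    simp only [Matrix.of_apply, h]⟩

lemma pointMass_eq_sum (n : ℕ) (x : S1) :
    pointMass n x = ∑ k ∈ Finset.Ioo (-(n : ℤ)) n, (fourier k x : ℂ) • toeplitzBasis n k := by
  refine Subtype.ext ?_
  ext i j
  simp only [Submodule.coe_sum, Submodule.coe_smul, Matrix.sum_apply, Matrix.smul_apply,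
    toeplitzBasis_apply, smul_eq_mul, mul_ite, mul_one, mul_zero]
  rw [Finset.sum_ite_eq, if_pos (by rw [Finset.mem_Ioo]; omega)]
  rfl

lemma posSemidef_pointMass (n : ℕ) (x : S1) :
    (pointMass n x : Matrix (Fin n) (Fin n) ℂ).PosSemidef := by
  convert Matrix.posSemidef_vecMulVec_self_star (fun i : Fin n => (fourier (i : ℤ) x : ℂ)) using 1
  ext i j
  change fourier ((i : ℤ) - j) x = fourier (i : ℤ) x * star (fourier (j : ℤ) x)
  rw [sub_eq_add_neg, fourier_add, fourier_neg]
  rfl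

open Polynomial in
/-- The polynomial of degree at most `2 (n - 1)` that encodes a functional on the Toeplitz
system. -/
noncomputable def symbolPoly (n : ℕ) (ψ : toeplitz n →ₗ[ℂ] ℂ) : ℂ[X] :=
  ∑ k ∈ Finset.Ioo (-(n : ℤ)) n, Polynomial.C (ψ (toeplitzBasis n k)) * X ^ (k + n - 1).toNat

/-- For `-n < k < n` the exponent `k + n - 1` is nonnegative, so `toNat` is injective there and the
monomials stay distinct. -/
lemma coeff_symbolPoly {n : ℕ} (ψ : toeplitz n →ₗ[ℂ] ℂ) {k : ℤ}
    (hk : k ∈ Finset.Ioo (-(n : ℤ)) n) :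
    (symbolPoly n ψ).coeff (k + n - 1).toNat = ψ (toeplitzBasis n k) := by
  simp only [symbolPoly, Polynomial.finsetSum_coeff, Polynomial.coeff_C_mul, Polynomial.coeff_X_pow]
  rw [Finset.sum_eq_single k]
  · simp
  · intro l hl hlk
    rw [Finset.mem_Ioo] at hl hk
    rw [if_neg (by omega), mul_zero]
  · intro h; exact absurd hk h

lemma natDegree_symbolPoly_le (n : ℕ) (ψ : toeplitz n →ₗ[ℂ] ℂ) :
    (symbolPoly n ψ).natDegree ≤ 2 * (n - 1) := by
  refine Polynomial.natDegree_sum_le_of_forall_le _ _ fun k hk => ?_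
  rw [Finset.mem_Ioo] at hk
  refine (Polynomial.natDegree_C_mul_X_pow_le _ _).trans ?_
  omega

lemma norm_fourier_apply (k : ℤ) (x : S1) : ‖(fourier k x : ℂ)‖ = 1 := Circle.norm_coe _

lemma fourier_eq_zpow (k : ℤ) (x : S1) : (fourier k x : ℂ) = (fourier 1 x : ℂ) ^ k := by
  rw [fourier_apply, fourier_apply, AddCircle.toCircle_zsmul, one_zsmul, Circle.coe_zpow]

/-- Since `pointMass` is `∑ z^k` times the basis, `ψ` takes on it the value of a Laurent polynomial.
The factor `z^{n-1}` clears the negative powers and has modulus one. -/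
lemma eval_symbolPoly (n : ℕ) [NeZero n] (ψ : toeplitz n →ₗ[ℂ] ℂ) (x : S1) :
    (symbolPoly n ψ).eval (fourier 1 x : ℂ) = (fourier 1 x : ℂ) ^ (n - 1) * ψ (pointMass n x) := by
  have hz : (fourier 1 x : ℂ) ≠ 0 := norm_ne_zero_iff.1 (by rw [norm_fourier_apply]; exact one_ne_zero)
  have hn := NeZero.pos n
  rw [symbolPoly, Polynomial.eval_finsetSum, pointMass_eq_sum, map_sum, Finset.mul_sum]
  refine Finset.sum_congr rfl fun k hk => ?_
  rw [Finset.mem_Ioo] at hk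
  rw [Polynomial.eval_mul, Polynomial.eval_C, Polynomial.eval_pow, Polynomial.eval_X, map_smul,
    fourier_eq_zpow k, smul_eq_mul, ← mul_assoc, ← zpow_natCast, ← zpow_natCast, ← zpow_add₀ hz,
    mul_comm]
  congr 2
  omega

lemma exists_fourier_one_eq {z : ℂ} (hz : ‖z‖ = 1) : ∃ x : S1, (fourier 1 x : ℂ) = z := by
  refine ⟨((Complex.arg z : ℝ) : S1), ?_⟩
  rw [fourier_coe_apply]
  have := Complex.norm_mul_exp_arg_mul_I z
  rw [hz] at this
  rw [← one_mul (Complex.exp _)]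
  convert this using 3
  · simp
  · push_cast
    have : (π : ℂ) ≠ 0 := by exact_mod_cast Real.pi_ne_zero
    field_simp

open Polynomial in
/-- The polynomial `(∑_{j < n} (w z)^j)²`. -/
noncomputable def geomSquare (n : ℕ) (w : ℂ) : ℂ[X] :=
  (∑ j ∈ Finset.range n, Polynomial.C (w ^ j) * X ^ j) ^ 2

lemma eval_geomSquare (n : ℕ) (w z : ℂ) :
    (geomSquare n w).eval z = (∑ j ∈ Finset.range n, (w * z) ^ j) ^ 2 := by
  simp [geomSquare, Polynomial.eval_finsetSum, mul_pow]

/-- Multiplying the geometric sum by `w a - 1` gives `(w a)^n - 1`, so `w a` is a root of unity. -/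
lemma norm_eq_one_of_isRoot_geomSquare {n : ℕ} [NeZero n] {w a : ℂ} (hw : ‖w‖ = 1)
    (h : (geomSquare n w).IsRoot a) : ‖a‖ = 1 := by
  rw [Polynomial.IsRoot, eval_geomSquare, sq_eq_zero_iff] at h
  have h1 := geom_sum_mul (w * a) n
  rw [h, zero_mul, eq_comm, sub_eq_zero] at h1
  have h2 : ‖w * a‖ = 1 := Complex.norm_eq_one_of_pow_eq_one h1 (NeZero.ne n)
  rwa [norm_mul, hw, one_mul] at h2

lemma natDegree_geomSquare {n : ℕ} [NeZero n] {w : ℂ} (hw : w ≠ 0) :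
    (geomSquare n w).natDegree = 2 * (n - 1) ∧ geomSquare n w ≠ 0 := by
  have hc : (∑ j ∈ Finset.range n, Polynomial.C (w ^ j) * Polynomial.X ^ j).coeff (n - 1)
      = w ^ (n - 1) := by
    simp only [Polynomial.finsetSum_coeff, Polynomial.coeff_C_mul, Polynomial.coeff_X_pow]
    rw [Finset.sum_eq_single (n - 1)]
    · simp
    · intro l _ hl; rw [if_neg (Ne.symm hl), mul_zero]
    · intro h; exact absurd (Finset.mem_range.2 (Nat.sub_lt (NeZero.pos n) one_pos)) h
  have hc0 : (∑ j ∈ Finset.range n, Polynomial.C (w ^ j) * Polynomial.X ^ j).coeff (n - 1) ≠ 0 := by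
    rw [hc]; exact pow_ne_zero _ hw
  constructor
  · rw [geomSquare, Polynomial.natDegree_pow]
    congr 1
    refine Polynomial.natDegree_eq_of_le_of_coeff_ne_zero ?_ hc0
    refine Polynomial.natDegree_sum_le_of_forall_le _ _ fun k hk => ?_
    rw [Finset.mem_range] at hk
    exact (Polynomial.natDegree_C_mul_X_pow_le _ _).trans (by omega)
  · refine pow_ne_zero _ fun h => hc0 ?_
    rw [h, Polynomial.coeff_zero]

/-- The summand separates in `i` and `j`, so the double sum is a geometric sum times its conjugate.
-/
lemma fejerFunctional_pointMass (n : ℕ) (θ x : S1) :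
    ‖fejerFunctional n θ (pointMass n x)‖
      = (n : ℝ)⁻¹ * ‖(geomSquare n (fourier 1 θ)).eval (fourier 1 x : ℂ)‖ := by
  have h : fejerFunctional n θ (pointMass n x)
      = (n : ℂ)⁻¹ * ((∑ j ∈ Finset.range n, ((fourier 1 θ : ℂ) * fourier 1 x) ^ j) *
        star (∑ j ∈ Finset.range n, ((fourier 1 θ : ℂ) * fourier 1 x) ^ j)) := by
    change (n : ℂ)⁻¹ * ∑ i : Fin n, ∑ j : Fin n, fourier ((i : ℤ) - j) θ * fourier ((i : ℤ) - j) x = _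
    rw [star_sum, Finset.sum_mul_sum, Finset.sum_range]
    congr 1
    refine Finset.sum_congr rfl fun i _ => ?_
    rw [Finset.sum_range]
    refine Finset.sum_congr rfl fun j _ => ?_
    have hpow : ∀ (m : ℕ) (y : S1), (fourier 1 y : ℂ) ^ m = fourier (m : ℤ) y := by
      intro m y; rw [fourier_eq_zpow (m : ℤ), zpow_natCast]
    rw [star_pow, star_mul', mul_pow, mul_pow, ← star_pow, ← star_pow, hpow, hpow, hpow, hpow,
      sub_eq_add_neg, fourier_add, fourier_add, fourier_neg, fourier_neg]
    simp only [← starRingEnd_apply]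
    ring
  rw [h, eval_geomSquare, norm_mul, norm_mul, norm_star, norm_pow, sq, norm_inv, Complex.norm_natCast]

lemma toeplitzBasis_zero (n : ℕ) : toeplitzBasis n 0 = toeplitzOne n := by
  refine Subtype.ext ?_
  ext i j
  rw [toeplitzBasis_apply]
  change _ = (1 : Matrix (Fin n) (Fin n) ℂ) i j
  rw [Matrix.one_apply]
  have : (i : ℤ) - j = 0 ↔ i = j := by rw [Fin.ext_iff]; omega
  simp [this]

/-- Domination gives divisibility by `geomSquare`, whose degree `2(n-1)` is already the largest
possible, so the quotient is constant. -/
lemma symbolPoly_eq_of_dominated {n : ℕ} [NeZero n] {θ : S1} {ψ : toeplitz n →ₗ[ℂ] ℂ} {C : ℝ}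
    (h : ∀ x, ‖ψ (pointMass n x)‖ ≤ C * ‖fejerFunctional n θ (pointMass n x)‖) :
    ∃ c : ℂ, symbolPoly n ψ = Polynomial.C c * geomSquare n (fourier 1 θ) := by
  have hw1 := norm_fourier_apply 1 θ
  have hw : (fourier 1 θ : ℂ) ≠ 0 := norm_ne_zero_iff.1 (by rw [hw1]; exact one_ne_zero)
  obtain ⟨hdeg, hne⟩ := natDegree_geomSquare (n := n) hw
  have hdvd : geomSquare n (fourier 1 θ) ∣ symbolPoly n ψ := by
    refine dvd_of_norm_le_on_circle hne (fun a ha => norm_eq_one_of_isRoot_geomSquare hw1 ha)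
      (C := C * (n : ℝ)⁻¹) fun z hz => ?_
    obtain ⟨x, rfl⟩ := exists_fourier_one_eq hz
    rw [eval_symbolPoly, norm_mul, norm_pow, norm_fourier_apply, one_pow, one_mul, mul_assoc,
      ← fejerFunctional_pointMass]
    exact h x
  obtain ⟨R, hR⟩ := hdvd
  by_cases hR0 : R = 0
  · exact ⟨0, by rw [hR, hR0]; simp⟩
  have h1 := natDegree_symbolPoly_le n ψ
  rw [hR, Polynomial.natDegree_mul hne hR0, hdeg] at h1
  obtain ⟨c, rfl⟩ := Polynomial.natDegree_eq_zero.1 (show R.natDegree = 0 by omega)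
  exact ⟨c, by rw [hR, mul_comm]⟩

lemma eq_fejerFunctional_of_dominated {n : ℕ} [NeZero n] {θ : S1} {ψ : toeplitz n →ₗ[ℂ] ℂ} {C : ℝ}
    (h1 : ψ (toeplitzOne n) = 1)
    (h : ∀ x, ‖ψ (pointMass n x)‖ ≤ C * ‖fejerFunctional n θ (pointMass n x)‖) :
    ψ = fejerFunctional n θ := by
  obtain ⟨c, hc⟩ := symbolPoly_eq_of_dominated h
  -- The Fejér functional dominates itself, so its polynomial is also a multiple of `geomSquare`.
  -- The middle coefficient, the value at the identity, then gives `c = d`.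
  obtain ⟨d, hd⟩ := symbolPoly_eq_of_dominated (n := n) (θ := θ) (ψ := fejerFunctional n θ) (C := 1)
    (fun x => by rw [one_mul])
  have hn := NeZero.pos n
  have h0 : (0 : ℤ) ∈ Finset.Ioo (-(n : ℤ)) n := by rw [Finset.mem_Ioo]; omega
  have hc1 := coeff_symbolPoly ψ h0
  have hd1 := coeff_symbolPoly (fejerFunctional n θ) h0
  rw [toeplitzBasis_zero, h1, hc, Polynomial.coeff_C_mul] at hc1
  rw [toeplitzBasis_zero, (fejerFunctional_mem n θ).2, hd, Polynomial.coeff_C_mul] at hd1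
  have hcd : c = d := mul_right_cancel₀ (right_ne_zero_of_mul_eq_one hc1) (hc1.trans hd1.symm)
  refine LinearMap.ext fun T => ?_
  obtain ⟨t, rfl⟩ := eq_sum_toeplitzBasis T
  rw [map_sum, map_sum]
  refine Finset.sum_congr rfl fun k hk => ?_
  rw [map_smul, map_smul, ← coeff_symbolPoly ψ hk, ← coeff_symbolPoly _ hk, hc, hd, hcd]

lemma norm_le_of_openSegment {n : ℕ} {φ ψ : toeplitz n →ₗ[ℂ] ℂ} (hφ : φ ∈ stateSet n)
    (hψ : ψ ∈ stateSet n) {a b : ℝ} (ha : 0 < a) (hb : 0 < b) {T : toeplitz n}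
    (hT : (T : Matrix (Fin n) (Fin n) ℂ).PosSemidef) :
    ‖φ T‖ ≤ a⁻¹ * ‖(a • φ + b • ψ) T‖ := by
  have h1 := hφ.1 T hT
  have h2 := hψ.1 T hT
  have h3 : (a : ℂ) * φ T ≤ (a • φ + b • ψ) T := by
    rw [LinearMap.add_apply, LinearMap.smul_apply, LinearMap.smul_apply, Complex.real_smul,
      Complex.real_smul]
    exact le_add_of_nonneg_right (mul_nonneg (by exact_mod_cast hb.le) h2)
  have h4 : 0 ≤ (a : ℂ) * φ T := mul_nonneg (by exact_mod_cast ha.le) h1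
  have h5 : ‖(a : ℂ) * φ T‖ ≤ ‖(a • φ + b • ψ) T‖ := by
    rwa [← Complex.real_le_real, Complex.norm_of_nonneg' h4, Complex.norm_of_nonneg' (h4.trans h3)]
  rw [norm_mul, Complex.norm_real, Real.norm_of_nonneg ha.le] at h5
  rwa [← div_eq_inv_mul, le_div_iff₀' ha]

theorem fejerStates_subset_pureStates (n : ℕ) [NeZero n] : fejerStates n ⊆ pureStates n := by
  rw [fejerStates_eq_range]
  rintro _ ⟨θ, rfl⟩
  refine ⟨fejerFunctional_mem n θ, ?_⟩
  rintro φ hφ ψ hψ ⟨a, b, ha, hb, -, hab⟩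
  refine eq_fejerFunctional_of_dominated (C := a⁻¹) hφ.2 fun x => ?_
  have hab' : a • φ + b • ψ = fejerFunctional n θ := hab
  rw [← hab']
  exact norm_le_of_openSegment hφ hψ ha hb (posSemidef_pointMass n x)

/-! ### The metric of the circle and smoothed triangle waves -/

lemma exists_coe_abs_eq_norm (x : S1) : ∃ y : ℝ, (y : S1) = x ∧ |y| = ‖x‖ := by
  obtain ⟨z, rfl⟩ := QuotientAddGroup.mk_surjective x
  refine ⟨z - round ((2 * π)⁻¹ * z) * (2 * π), ?_, (AddCircle.norm_eq (2 * π)).symm⟩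
  refine (QuotientAddGroup.eq_iff_sub_mem.2 ?_)
  refine AddSubgroup.mem_zmultiples_iff.2 ⟨-round ((2 * π)⁻¹ * z), ?_⟩
  rw [zsmul_eq_mul]
  push_cast
  ring

/-- Lifting a shortest arc to the line makes the mean value inequality on `ℝ` available. -/
lemma exists_coe_sub_abs_eq_dist (s t : S1) :
    ∃ x y : ℝ, (x : S1) = s ∧ (y : S1) = t ∧ |x - y| = dist s t := by
  obtain ⟨y, rfl⟩ := QuotientAddGroup.mk_surjective t
  obtain ⟨z, hz, hz'⟩ := exists_coe_abs_eq_norm (s - (y : S1))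
  refine ⟨y + z, y, ?_, rfl, ?_⟩
  · rw [AddCircle.coe_add, hz]; abel
  · rw [add_sub_cancel_left, hz', dist_eq_norm]

lemma fourier_one_coe (x : ℝ) : (fourier 1 (x : S1) : ℂ) = Complex.exp (x * Complex.I) := by
  rw [fourier_coe_apply]
  congr 1
  have : (π : ℂ) ≠ 0 := by exact_mod_cast Real.pi_ne_zero
  push_cast
  field_simp

lemma re_fourier_one_coe (x : ℝ) : (fourier 1 (x : S1) : ℂ).re = Real.cos x := by
  rw [fourier_one_coe, Complex.exp_ofReal_mul_I_re]

lemma im_fourier_one_coe (x : ℝ) : (fourier 1 (x : S1) : ℂ).im = Real.sin x := by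
  rw [fourier_one_coe, Complex.exp_ofReal_mul_I_im]

lemma arcsin_re_fourier_one (x : S1) : Real.arcsin (fourier 1 x : ℂ).re = π / 2 - ‖x‖ := by
  have hx := AddCircle.norm_le_half_period (2 * π) (x := x) (by positivity)
  obtain ⟨y, rfl, hy⟩ := exists_coe_abs_eq_norm x
  rw [← hy] at hx ⊢
  rw [re_fourier_one_coe, ← Real.cos_abs, Real.arcsin_eq_pi_div_two_sub_arccos,
    Real.arccos_cos (abs_nonneg y)]
  rw [abs_of_pos Real.two_pi_pos] at hx
  linarith

/-- The function `arcsin (r cos x)`, which is smooth for `r < 1` and tends to the triangle wave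
`π / 2 - |x|` as `r → 1`. -/
noncomputable def wave (r : ℝ) : C(S1, ℂ) where
  toFun x := (Real.arcsin (r * (fourier 1 x : ℂ).re) : ℝ)
  continuous_toFun := by
    have := Real.continuous_arcsin
    fun_prop

lemma wave_coe (r x : ℝ) : wave r (x : S1) = (Real.arcsin (r * Real.cos x) : ℝ) := by
  rw [← re_fourier_one_coe]; rfl

lemma one_sub_sq_pos {r : ℝ} (hr0 : 0 ≤ r) (hr : r < 1) (c : ℝ) (hc : |c| ≤ 1) :
    0 < 1 - (r * c) ^ 2 := by
  have h1 : |r * c| < 1 := by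
    rw [abs_mul, abs_of_nonneg hr0]
    nlinarith [abs_nonneg c]
  have := (sq_lt_one_iff_abs_lt_one _).2 h1
  linarith

/-- The derivative of `wave r`. -/
noncomputable def waveDeriv (r : ℝ) (hr0 : 0 ≤ r) (hr : r < 1) : C(S1, ℂ) where
  toFun x := (-(r * (fourier 1 x : ℂ).im) / √(1 - (r * (fourier 1 x : ℂ).re) ^ 2) : ℝ)
  continuous_toFun := by
    have h : ∀ x : S1, √(1 - (r * (fourier 1 x : ℂ).re) ^ 2) ≠ 0 := fun x =>
      (Real.sqrt_pos.2 (one_sub_sq_pos hr0 hr _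
        ((Complex.abs_re_le_norm _).trans_eq (norm_fourier_apply 1 x)))).ne'
    refine Complex.continuous_ofReal.comp (Continuous.div (by fun_prop) (by fun_prop) h)

lemma hasDerivAt_wave {r : ℝ} (hr0 : 0 ≤ r) (hr : r < 1) (x : ℝ) :
    HasDerivAt (fun y : ℝ => wave r (y : S1)) (waveDeriv r hr0 hr (x : S1)) x := by
  have hpos := one_sub_sq_pos hr0 hr _ (Real.abs_cos_le_one x)
  have h1 := (Real.hasDerivAt_arcsin (x := r * Real.cos x) (by intro h; rw [h] at hpos; norm_num at hpos)
    (by intro h; rw [h] at hpos; norm_num at hpos)).comp x ((Real.hasDerivAt_cos x).const_mul r)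
  have h2 := h1.ofReal_comp
  simp only [wave_coe]
  refine h2.congr_deriv ?_
  change _ = ((_ : ℝ) : ℂ)
  rw [re_fourier_one_coe, im_fourier_one_coe]
  congr 1
  ring

/-- The claim amounts to `r² sin² ≤ 1 - r² cos²`, that is `r² ≤ 1`. -/
lemma norm_waveDeriv_le {r : ℝ} (hr0 : 0 ≤ r) (hr : r < 1) (x : S1) :
    ‖waveDeriv r hr0 hr x‖ ≤ 1 := by
  set z : ℂ := fourier 1 x with hz
  have hn : z.re ^ 2 + z.im ^ 2 = 1 := by
    have := Complex.sq_norm z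
    rw [hz, norm_fourier_apply, ← hz, Complex.normSq_apply] at this
    linarith
  have hpos := one_sub_sq_pos hr0 hr z.re ((Complex.abs_re_le_norm _).trans_eq (norm_fourier_apply 1 x))
  change ‖((-(r * z.im) / √(1 - (r * z.re) ^ 2) : ℝ) : ℂ)‖ ≤ 1
  rw [Complex.norm_real, Real.norm_eq_abs, abs_div, abs_of_pos (Real.sqrt_pos.2 hpos),
    div_le_one (Real.sqrt_pos.2 hpos), abs_neg]
  refine Real.abs_le_sqrt ?_
  nlinarith [mul_nonneg hr0 (sub_nonneg.2 hr.le)]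

lemma contDiff_wave {r : ℝ} (hr0 : 0 ≤ r) (hr : r < 1) :
    ContDiff ℝ ∞ (fun x : ℝ => wave r (x : S1)) := by
  simp only [wave_coe]
  refine Complex.ofRealCLM.contDiff.comp (contDiff_iff_contDiffAt.2 fun x => ?_)
  have hpos := one_sub_sq_pos hr0 hr _ (Real.abs_cos_le_one x)
  refine (Real.contDiffAt_arcsin (by intro h; rw [h] at hpos; norm_num at hpos)
    (by intro h; rw [h] at hpos; norm_num at hpos)).comp x ?_
  exact (contDiff_const.mul Real.contDiff_cos).contDiffAt

/-- By uniform continuity of `arcsin` on `[-1, 1]`, `wave r` is within `ε / 2` of the triangle wave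
`π / 2 - ‖x‖` everywhere once `1 - r` is small; two such errors make `ε`. -/
lemma exists_wave_approx {ε : ℝ} (hε : 0 < ε) :
    ∃ r : ℝ, 0 ≤ r ∧ r < 1 ∧ ∀ x : S1, ‖x‖ - ε ≤ ‖wave r x - wave r 0‖ := by
  have huc := (isCompact_Icc (a := (-1 : ℝ)) (b := 1)).uniformContinuousOn_of_continuous
    Real.continuous_arcsin.continuousOn
  obtain ⟨δ, hδ, H⟩ := Metric.uniformContinuousOn_iff.1 huc (ε / 2) (half_pos hε)
  have hr : ∃ r : ℝ, 0 ≤ r ∧ r < 1 ∧ 1 - r < δ :=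
    ⟨max 0 (1 - δ / 2), le_max_left _ _, max_lt one_pos (by linarith), by
      have := le_max_right 0 (1 - δ / 2); linarith⟩
  obtain ⟨r, hr0, hr1, hrδ⟩ := hr
  refine ⟨r, hr0, hr1, fun x => ?_⟩
  have key : ∀ y : S1, |Real.arcsin (r * (fourier 1 y : ℂ).re) - (π / 2 - ‖y‖)| ≤ ε / 2 := by
    intro y
    rw [← arcsin_re_fourier_one]
    have hc : |(fourier 1 y : ℂ).re| ≤ 1 :=
      (Complex.abs_re_le_norm _).trans_eq (norm_fourier_apply 1 y)
    set c := (fourier 1 y : ℂ).re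
    refine (H _ (abs_le.1 ?_) _ (abs_le.1 hc) ?_).le
    · rw [abs_mul, abs_of_nonneg hr0]
      nlinarith [abs_nonneg c]
    · rw [Real.dist_eq, show r * c - c = -((1 - r) * c) by ring, abs_neg, abs_mul,
        abs_of_pos (by linarith : 0 < 1 - r)]
      nlinarith [abs_nonneg c]
  have h1 := abs_le.1 (key x)
  have h2 := abs_le.1 (key 0)
  rw [norm_zero] at h2
  change _ ≤ ‖((Real.arcsin (r * (fourier 1 x : ℂ).re) : ℝ) : ℂ) -
    ((Real.arcsin (r * (fourier 1 (0 : S1) : ℂ).re) : ℝ) : ℂ)‖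
  rw [← Complex.ofReal_sub, Complex.norm_real, Real.norm_eq_abs, abs_sub_comm]
  refine le_trans ?_ (le_abs_self _)
  linarith [h1.2, h2.1]

/-- The arc-length metric is the Connes distance of the circle. -/
theorem isLUB_dist (s t : S1) :
    IsLUB {r : ℝ | ∃ g : S1 → ℂ, ContDiff ℝ ∞ (fun x : ℝ => g x) ∧
      (∀ x : ℝ, ‖deriv (fun y : ℝ => g y) x‖ ≤ 1) ∧ r = ‖g s - g t‖} (dist s t) := by
  constructor
  · rintro _ ⟨g, hg, hg', rfl⟩
    obtain ⟨x, y, rfl, rfl, hxy⟩ := exists_coe_sub_abs_eq_dist s t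
    have h := convex_univ.norm_image_sub_le_of_norm_deriv_le (𝕜 := ℝ) (f := fun y : ℝ => g y)
      (fun z _ => (hg.differentiable (by simp)) z) (fun z _ => hg' z)
      (Set.mem_univ y) (Set.mem_univ x)
    rw [one_mul, Real.norm_eq_abs, hxy] at h
    exact h
  · intro b hb
    refine le_of_forall_pos_le_add fun ε hε => ?_
    obtain ⟨r, hr0, hr, H⟩ := exists_wave_approx hε
    obtain ⟨t₀, rfl⟩ := QuotientAddGroup.mk_surjective t
    have h1 := H (s - (t₀ : S1))
    have h2 : ‖wave r (s - (t₀ : S1)) - wave r 0‖ ≤ b := by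
      -- The competitor is the wave with its peak moved to `t`.
      refine hb ⟨fun x => wave r (x - (t₀ : S1)), ?_, fun x => ?_, ?_⟩
      · simp only [← AddCircle.coe_sub]
        exact (contDiff_wave hr0 hr).comp (contDiff_id.sub contDiff_const)
      · simp only [← AddCircle.coe_sub]
        rw [((hasDerivAt_wave hr0 hr (x - t₀)).comp_sub_const x t₀).deriv]
        exact norm_waveDeriv_le hr0 hr _
      · simp only []
        erw [sub_self]
    rw [dist_eq_norm]
    change ‖s - (t₀ : S1)‖ ≤ _
    linarith

/-! ### Operator norms of truncations -/

lemma integrable_of_continuous {f : S1 → ℂ} (hf : Continuous f) :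
    MeasureTheory.Integrable f AddCircle.haarAddCircle :=
  hf.integrable_of_hasCompactSupport (HasCompactSupport.of_compactSpace _)

/-- The trigonometric polynomial with coefficients `v`. -/
noncomputable def trigPoly {n : ℕ} (v : EuclideanSpace ℂ (Fin n)) : C(S1, ℂ) :=
  ∑ j : Fin n, v j • fourier (j : ℤ)

lemma trigPoly_apply {n : ℕ} (v : EuclideanSpace ℂ (Fin n)) (x : S1) :
    trigPoly v x = ∑ j : Fin n, v j * fourier (j : ℤ) x := by
  simp only [trigPoly, ContinuousMap.sum_apply, ContinuousMap.smul_apply, smul_eq_mul]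

/-- The truncation is the compression of multiplication by `h` to trigonometric polynomials.
Frequencies `0, …, n - 1` serve as well as `1, …, n`, because only differences enter. -/
lemma inner_truncation {n : ℕ} (h : C(S1, ℂ)) (u v : EuclideanSpace ℂ (Fin n)) :
    inner ℂ u (Matrix.toEuclideanCLM (n := Fin n) (𝕜 := ℂ)
      (truncation n h : Matrix (Fin n) (Fin n) ℂ) v)
      = ∫ x, h x * (star (trigPoly u x) * trigPoly v x) ∂AddCircle.haarAddCircle := by
  have h1 : ∀ x : S1, h x * (star (trigPoly u x) * trigPoly v x)
      = ∑ i : Fin n, ∑ j : Fin n, (star (u i) * v j) * (fourier (-((i : ℤ) - j)) x • h x) := by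
    intro x
    rw [trigPoly_apply, trigPoly_apply, star_sum, Finset.sum_mul_sum, Finset.mul_sum]
    refine Finset.sum_congr rfl fun i _ => ?_
    rw [Finset.mul_sum]
    refine Finset.sum_congr rfl fun j _ => ?_
    rw [show -((i : ℤ) - j) = -(i : ℤ) + j by ring, fourier_add, fourier_neg, star_mul',
      smul_eq_mul, ← starRingEnd_apply (fourier (i : ℤ) x : ℂ)]
    ring
  simp only [h1]
  rw [MeasureTheory.integral_finsetSum _ fun i _ => integrable_of_continuous (by fun_prop),
    PiLp.inner_apply]
  refine Finset.sum_congr rfl fun i _ => ?_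
  rw [MeasureTheory.integral_finsetSum _ fun j _ => integrable_of_continuous (by fun_prop),
    Matrix.ofLp_toEuclideanCLM, RCLike.inner_apply, Matrix.mulVec, dotProduct, Finset.sum_mul]
  refine Finset.sum_congr rfl fun j _ => ?_
  rw [MeasureTheory.integral_const_mul]
  change fourierCoeff h ((i : ℤ) - j) * v j * star (u i) = star (u i) * v j * fourierCoeff h ((i : ℤ) - j)
  ring

lemma truncation_one (n : ℕ) : truncation n 1 = toeplitzOne n := by
  rw [← toeplitzBasis_zero, toeplitzBasis]
  congr 1
  ext x
  exact fourier_zero.symm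

/-- Parseval's identity, as the case `h = 1` of the compression formula. -/
lemma integral_norm_sq_trigPoly {n : ℕ} (v : EuclideanSpace ℂ (Fin n)) :
    ∫ x, ‖trigPoly v x‖ ^ 2 ∂AddCircle.haarAddCircle = ‖v‖ ^ 2 := by
  have h := inner_truncation 1 v v
  rw [truncation_one] at h
  have h2 : (∫ x, (1 : C(S1, ℂ)) x * (star (trigPoly v x) * trigPoly v x) ∂AddCircle.haarAddCircle)
      = ((∫ x, ‖trigPoly v x‖ ^ 2 ∂AddCircle.haarAddCircle : ℝ) : ℂ) := by
    rw [← integral_complex_ofReal]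
    refine MeasureTheory.integral_congr_ae (Eventually.of_forall fun x => ?_)
    simp only [ContinuousMap.one_apply, one_mul]
    rw [← starRingEnd_apply, Complex.conj_mul']
    push_cast
    rfl
  rw [h2] at h
  have h3 : (Matrix.toEuclideanCLM (n := Fin n) (𝕜 := ℂ)
      (toeplitzOne n : Matrix (Fin n) (Fin n) ℂ)) v = v := by
    change (Matrix.toEuclideanCLM (n := Fin n) (𝕜 := ℂ) (1 : Matrix (Fin n) (Fin n) ℂ)) v = v
    rw [map_one]; rfl
  rw [h3, inner_self_eq_norm_sq_to_K] at h
  exact Complex.ofReal_injective (h.symm.trans (Complex.ofReal_pow _ 2).symm)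

/-- Truncation does not increase the norm. -/
lemma norm_truncation_le {n : ℕ} {h : C(S1, ℂ)} {C : ℝ} (hC : 0 < C) (hh : ∀ x, ‖h x‖ ≤ C) :
    ‖Matrix.toEuclideanCLM (n := Fin n) (𝕜 := ℂ)
      (truncation n h : Matrix (Fin n) (Fin n) ℂ)‖ ≤ C := by
  set A := Matrix.toEuclideanCLM (n := Fin n) (𝕜 := ℂ)
      (truncation n h : Matrix (Fin n) (Fin n) ℂ) with hA
  -- The pointwise bound `|u||v| ≤ (|u|² + |v|²) / 2` replaces the Cauchy–Schwarz inequality for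
  -- integrals.
  have key : ∀ u v : EuclideanSpace ℂ (Fin n),
      ‖inner ℂ u (A v)‖ ≤ C * ((‖u‖ ^ 2 + ‖v‖ ^ 2) / 2) := by
    intro u v
    have hint : ∀ w : EuclideanSpace ℂ (Fin n),
        MeasureTheory.Integrable (fun x => ‖trigPoly w x‖ ^ 2) AddCircle.haarAddCircle := fun w =>
      Continuous.integrable_of_hasCompactSupport (by fun_prop) (HasCompactSupport.of_compactSpace _)
    rw [hA, inner_truncation, ← integral_norm_sq_trigPoly u, ← integral_norm_sq_trigPoly v,
      ← MeasureTheory.integral_add (hint u) (hint v), ← MeasureTheory.integral_div,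
      ← MeasureTheory.integral_const_mul]
    refine MeasureTheory.norm_integral_le_of_norm_le
      ((((hint u).add (hint v)).div_const 2).const_mul C) (Eventually.of_forall fun x => ?_)
    rw [norm_mul, norm_mul, norm_star]
    refine mul_le_mul (hh x) ?_ (by positivity) hC.le
    nlinarith [sq_nonneg (‖trigPoly u x‖ - ‖trigPoly v x‖)]
  refine A.opNorm_le_bound hC.le fun v => ?_
  -- The scaling by `C` balances the two squares: the bound becomes `‖A v‖² ≤ (‖A v‖² + (C ‖v‖)²) /
  -- 2`.
  have h1 := key (A v) (((C : ℝ) : ℂ) • v)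
  rw [map_smul, inner_smul_right, inner_self_eq_norm_sq_to_K, norm_mul, norm_smul, Complex.norm_real,
    Real.norm_of_nonneg hC.le] at h1
  have h2 : ‖((‖A v‖ : ℂ)) ^ 2‖ = ‖A v‖ ^ 2 := by simp
  have h3 : C * ‖A v‖ ^ 2 ≤ C * ((‖A v‖ ^ 2 + (C * ‖v‖) ^ 2) / 2) := by
    refine le_trans (le_of_eq ?_) h1
    rw [← h2]; rfl
  have h4 := le_of_mul_le_mul_left h3 hC
  exact abs_le_of_sq_le_sq' (by linarith) (by positivity) |>.2

/-- The vector states of the Fejér kernels are contractive for the operator norm. -/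
lemma norm_fejer_sum_le {n : ℕ} [NeZero n] (θ : S1) (A : Matrix (Fin n) (Fin n) ℂ) :
    ‖(n : ℂ)⁻¹ * ∑ i : Fin n, ∑ j : Fin n, fourier ((i : ℤ) - j) θ * A i j‖
      ≤ ‖Matrix.toEuclideanCLM (n := Fin n) (𝕜 := ℂ) A‖ := by
  set L := Matrix.toEuclideanCLM (n := Fin n) (𝕜 := ℂ) A with hL
  set v : EuclideanSpace ℂ (Fin n) := WithLp.toLp 2 fun j => (fourier (-(j : ℤ)) θ : ℂ) with hv
  have hnorm : ‖v‖ ^ 2 = n := by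
    rw [EuclideanSpace.norm_sq_eq]
    simp only [hv, norm_fourier_apply, one_pow, Finset.sum_const, Finset.card_univ,
      Fintype.card_fin, nsmul_eq_mul, mul_one]
  have hinner : inner ℂ v (L v)
      = ∑ i : Fin n, ∑ j : Fin n, fourier ((i : ℤ) - j) θ * A i j := by
    rw [PiLp.inner_apply]
    refine Finset.sum_congr rfl fun i _ => ?_
    rw [hL, Matrix.ofLp_toEuclideanCLM, RCLike.inner_apply, Matrix.mulVec, dotProduct,
      Finset.sum_mul]
    refine Finset.sum_congr rfl fun j _ => ?_
    change A i j * (fourier (-(j : ℤ)) θ : ℂ) * (starRingEnd ℂ) (fourier (-(i : ℤ)) θ : ℂ) = _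
    rw [← fourier_neg, neg_neg, sub_eq_add_neg, fourier_add]
    ring
  have hn : (0 : ℝ) < n := Nat.cast_pos.2 (NeZero.pos n)
  rw [← hinner, norm_mul, norm_inv, Complex.norm_natCast, inv_mul_le_iff₀ hn, ← hnorm]
  calc ‖inner ℂ v (L v)‖ ≤ ‖v‖ * ‖L v‖ := norm_inner_le_norm _ _
    _ ≤ ‖v‖ * (‖L‖ * ‖v‖) := by gcongr; exact L.le_opNorm v
    _ = ‖v‖ ^ 2 * ‖L‖ := by ring

/-! ### Comparison of the Connes distance with the arc length -/

lemma commutator_apply {n : ℕ} (T : toeplitz n) (i j : Fin n) :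
    (dirac n * (T : Matrix (Fin n) (Fin n) ℂ) - T * dirac n) i j
      = (((i : ℤ) - (j : ℤ) : ℤ) : ℂ) * (T : Matrix (Fin n) (Fin n) ℂ) i j := by
  rw [Matrix.sub_apply, dirac, Matrix.diagonal_mul, Matrix.mul_diagonal]
  push_cast
  ring

lemma hasDerivAt_fourier_two_pi (k : ℤ) (x : ℝ) :
    HasDerivAt (fun y : ℝ => (fourier k (y : S1) : ℂ)) (Complex.I * k * fourier k (x : S1)) x := by
  refine (hasDerivAt_fourier (2 * π) k x).congr_deriv ?_
  have : (π : ℂ) ≠ 0 := by exact_mod_cast Real.pi_ne_zero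
  push_cast
  field_simp

/-- Differentiating `e^{i(k-l)θ}` produces `i(k - l)`, and `k - l` is the factor by which the
commutator with `D_n` multiplies the entry `(k, l)`. -/
lemma hasDerivAt_fejerFunctional {n : ℕ} (T : toeplitz n) (x : ℝ) :
    HasDerivAt (fun y : ℝ => fejerFunctional n (y : S1) T)
      (Complex.I * ((n : ℂ)⁻¹ * ∑ i : Fin n, ∑ j : Fin n, fourier ((i : ℤ) - j) (x : S1) *
        (dirac n * (T : Matrix (Fin n) (Fin n) ℂ) - T * dirac n) i j)) x := by
  have h : HasDerivAt (fun y : ℝ => fejerFunctional n (y : S1) T)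
      ((n : ℂ)⁻¹ * ∑ i : Fin n, ∑ j : Fin n,
        (Complex.I * (((i : ℤ) - (j : ℤ) : ℤ) : ℂ) * fourier ((i : ℤ) - j) (x : S1)) *
          (T : Matrix (Fin n) (Fin n) ℂ) i j) x := by
    change HasDerivAt (fun y : ℝ => (n : ℂ)⁻¹ * ∑ i : Fin n, ∑ j : Fin n,
      fourier ((i : ℤ) - j) (y : S1) * (T : Matrix (Fin n) (Fin n) ℂ) i j) _ x
    refine HasDerivAt.const_mul _ (HasDerivAt.fun_sum fun i _ => HasDerivAt.fun_sum fun j _ => ?_)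
    exact (hasDerivAt_fourier_two_pi ((i : ℤ) - j) x).mul_const _
  refine h.congr_deriv ?_
  rw [mul_left_comm]
  congr 1
  rw [Finset.mul_sum]
  refine Finset.sum_congr rfl fun i _ => ?_
  rw [Finset.mul_sum]
  refine Finset.sum_congr rfl fun j _ => ?_
  rw [commutator_apply]
  ring

/-- The map from the circle to the Fejér states is 1-Lipschitz. -/
lemma dist_fejerState_le_dist (n : ℕ) [NeZero n] (s t : S1) :
    dist (fejerState n s) (fejerState n t) ≤ dist s t := by
  obtain ⟨x, y, rfl, rfl, hxy⟩ := exists_coe_sub_abs_eq_dist s t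
  refine connesDist_le _ _ fun T hT => ?_
  have h := convex_univ.norm_image_sub_le_of_norm_hasDerivWithin_le (𝕜 := ℝ) (C := 1)
    (fun z _ => (hasDerivAt_fejerFunctional T z).hasDerivWithinAt)
    (fun z _ => by
      rw [norm_mul, Complex.norm_I, one_mul]
      exact (norm_fejer_sum_le _ _).trans hT)
    (Set.mem_univ y) (Set.mem_univ x)
  rw [one_mul, Real.norm_eq_abs, hxy] at h
  exact h

/-- Fourier coefficients of a derivative. -/
lemma fourierCoeff_of_hasDerivAt {g g' : C(S1, ℂ)}
    (h : ∀ x : ℝ, HasDerivAt (fun y : ℝ => g (y : S1)) (g' (x : S1)) x) (k : ℤ) :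
    fourierCoeff g' k = Complex.I * k * fourierCoeff g k := by
  have hI := intervalIntegral.integral_mul_deriv_eq_deriv_mul (a := 0) (b := 0 + 2 * π)
    (fun x _ => hasDerivAt_fourier_two_pi (-k) x) (fun x _ => h x)
    (Continuous.intervalIntegrable (by
      have := (fourier (T := 2 * π) (-k)).continuous.comp (AddCircle.continuous_mk' (2 * π))
      exact continuous_const.mul this) _ _)
    (Continuous.intervalIntegrable (g'.continuous.comp (AddCircle.continuous_mk' (2 * π))) _ _)
  -- Periodicity cancels the boundary terms of the integration by parts.
  have hper : ((0 + 2 * π : ℝ) : S1) = ((0 : ℝ) : S1) := by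
    rw [zero_add, AddCircle.coe_period, QuotientAddGroup.mk_zero]
  rw [hper, sub_self, zero_sub] at hI
  rw [fourierCoeff_eq_intervalIntegral g' k 0, fourierCoeff_eq_intervalIntegral g k 0]
  simp only [smul_eq_mul]
  rw [hI, mul_smul_comm, ← intervalIntegral.integral_const_mul, ← intervalIntegral.integral_neg]
  congr 2
  ext x
  push_cast
  ring

/-- Integration by parts gives `[D_n, P_n g P_n] = -i P_n g' P_n`, and truncation is contractive. -/
lemma lipNorm_truncation_le {n : ℕ} {g g' : C(S1, ℂ)}
    (h : ∀ x : ℝ, HasDerivAt (fun y : ℝ => g (y : S1)) (g' (x : S1)) x) (hg' : ∀ x, ‖g' x‖ ≤ 1) :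
    lipNorm (truncation n g) ≤ 1 := by
  have h1 : dirac n * (truncation n g : Matrix (Fin n) (Fin n) ℂ) - truncation n g * dirac n
      = (-Complex.I) • (truncation n g' : Matrix (Fin n) (Fin n) ℂ) := by
    ext i j
    rw [commutator_apply, Matrix.smul_apply]
    change _ * fourierCoeff g _ = _ • fourierCoeff g' _
    rw [fourierCoeff_of_hasDerivAt h, smul_eq_mul, mul_assoc, neg_mul, ← mul_assoc Complex.I,
      Complex.I_mul_I]
    ring
  rw [lipNorm, h1, map_smul, norm_smul, norm_neg, Complex.norm_I, one_mul]
  exact norm_truncation_le one_pos hg'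

/-! ### Fejér's theorem -/

/-- The diagonal `k` has `n - |k|` entries, whence the Cesàro weights. -/
lemma fejerFunctional_toeplitzBasis (n : ℕ) [NeZero n] (θ : S1) {k : ℤ}
    (hk : k ∈ Finset.Ioo (-(n : ℤ)) n) :
    fejerFunctional n θ (toeplitzBasis n k) = (1 - ((|k| : ℤ) : ℂ) / n) * fourier k θ := by
  have hn : (n : ℂ) ≠ 0 := Nat.cast_ne_zero.2 (NeZero.ne n)
  change (n : ℂ)⁻¹ * ∑ i : Fin n, ∑ j : Fin n,
    fourier ((i : ℤ) - j) θ * (toeplitzBasis n k : Matrix (Fin n) (Fin n) ℂ) i j = _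
  simp only [toeplitzBasis_apply, mul_ite, mul_one, mul_zero]
  rw [← Finset.sum_product', Finset.univ_product_univ, ← Finset.sum_filter,
    Finset.sum_congr rfl (g := fun _ => (fourier k θ : ℂ)) (fun p hp => by
      rw [(Finset.mem_filter.1 hp).2]), Finset.sum_const, nsmul_eq_mul]
  have hcard : ((Finset.univ.filter fun p : Fin n × Fin n => (p.1 : ℤ) - p.2 = k).card : ℂ)
      = n - ((|k| : ℤ) : ℂ) := by
    exact_mod_cast congrArg (Int.cast : ℤ → ℂ) (card_diagonal n k hk)
  rw [hcard]
  field_simp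

lemma truncation_add (n : ℕ) (f g : C(S1, ℂ)) :
    truncation n (f + g) = truncation n f + truncation n g := by
  refine Subtype.ext ?_
  ext i j
  change fourierCoeff (f + g : S1 → ℂ) _ = fourierCoeff f _ + fourierCoeff g _
  rw [fourierCoeff.add (integrable_of_continuous f.continuous) (integrable_of_continuous g.continuous)]
  rfl

lemma truncation_smul (n : ℕ) (c : ℂ) (f : C(S1, ℂ)) :
    truncation n (c • f) = c • truncation n f := by
  refine Subtype.ext ?_
  ext i j
  exact fourierCoeff.const_smul (T := 2 * π) (f : S1 → ℂ) c _

/-- This bound is uniform in `n` and `θ`, which lets convergence pass from trigonometric polynomials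
to their uniform limits. -/
lemma norm_fejerFunctional_truncation_le {n : ℕ} [NeZero n] (θ : S1) {f : C(S1, ℂ)} {C : ℝ}
    (hC : 0 < C) (hf : ∀ x, ‖f x‖ ≤ C) : ‖fejerFunctional n θ (truncation n f)‖ ≤ C :=
  (norm_fejer_sum_le θ _).trans (norm_truncation_le hC hf)

/-- The Cesàro means of the Fourier series of `f` converge uniformly to `f`. -/
def FejerConverges (f : C(S1, ℂ)) : Prop :=
  ∀ ε > 0, ∀ᶠ n : ℕ+ in atTop, ∀ θ : S1, ‖fejerFunctional n θ (truncation n f) - f θ‖ ≤ ε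

/-- For `n > |k|` the error is exactly `|k| / n`, whatever `θ` is. -/
lemma fejerConverges_fourier (k : ℤ) : FejerConverges (fourier k) := by
  intro ε hε
  have h1 : ∀ᶠ n : ℕ in atTop, (|k| : ℤ) < (n : ℤ) ∧ ((|k| : ℤ) : ℝ) / n ≤ ε := by
    have ht : Tendsto (fun n : ℕ => ((|k| : ℤ) : ℝ) / n) atTop (𝓝 0) :=
      tendsto_const_div_atTop_nhds_zero_nat _
    filter_upwards [ht.eventually (Iic_mem_nhds hε), eventually_gt_atTop k.natAbs] with n h h'
    exact ⟨by rw [Int.abs_eq_natAbs]; exact_mod_cast h', h⟩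
  have h2 := tendsto_PNat_val_atTop_atTop.eventually h1
  filter_upwards [h2] with n hn θ
  obtain ⟨hk, hle⟩ := hn
  have hk' : k ∈ Finset.Ioo (-((n : ℕ) : ℤ)) ((n : ℕ) : ℤ) :=
    Finset.mem_Ioo.2 (abs_lt.1 hk)
  have h3 := fejerFunctional_toeplitzBasis (n : ℕ) θ hk'
  rw [toeplitzBasis] at h3
  rw [h3, sub_mul, one_mul, sub_sub_cancel_left, norm_neg, norm_mul, norm_fourier_apply, mul_one,
    norm_div, Complex.norm_intCast, Complex.norm_natCast, abs_of_nonneg (by positivity)]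
  exact hle

lemma FejerConverges.add {f g : C(S1, ℂ)} (hf : FejerConverges f) (hg : FejerConverges g) :
    FejerConverges (f + g) := by
  intro ε hε
  filter_upwards [hf (ε / 2) (half_pos hε), hg (ε / 2) (half_pos hε)] with n h1 h2 θ
  rw [truncation_add, map_add, ContinuousMap.add_apply, add_sub_add_comm]
  exact (norm_add_le _ _).trans (by linarith [h1 θ, h2 θ])

lemma FejerConverges.smul {f : C(S1, ℂ)} (c : ℂ) (hf : FejerConverges f) :
    FejerConverges (c • f) := by
  intro ε hε
  filter_upwards [hf (ε / (‖c‖ + 1)) (by positivity)] with n h1 θ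
  rw [truncation_smul, map_smul, ContinuousMap.smul_apply, ← smul_sub, norm_smul]
  have h2 := h1 θ
  rw [le_div_iff₀ (by positivity)] at h2
  nlinarith [norm_nonneg (fejerFunctional n θ (truncation n f) - f θ)]

/-- Fejér's theorem. -/
theorem fejerConverges (f : C(S1, ℂ)) : FejerConverges f := by
  have hspan : ∀ p ∈ Submodule.span ℂ (Set.range (fourier (T := 2 * π))), FejerConverges p := by
    intro p hp
    induction hp using Submodule.span_induction with
    | mem p hp => obtain ⟨k, rfl⟩ := hp; exact fejerConverges_fourier k
    | zero => simpa using (fejerConverges_fourier 0).smul 0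
    | add p q _ _ hp hq => exact hp.add hq
    | smul c p _ hp => exact hp.smul c
  have hmem : f ∈ (Submodule.span ℂ (Set.range (fourier (T := 2 * π)))).topologicalClosure := by
    rw [span_fourier_closure_eq_top]; trivial
  intro ε hε
  obtain ⟨p, hp, hfp⟩ := Metric.mem_closure_iff.1 hmem (ε / 3) (by positivity)
  have hle : ∀ x, ‖(f - p) x‖ ≤ ε / 3 := fun x =>
    ((f - p).norm_coe_le_norm x).trans (by rw [← dist_eq_norm]; exact hfp.le)
  filter_upwards [hspan p hp (ε / 3) (by positivity)] with n hn θ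
  have h1 := norm_fejerFunctional_truncation_le (n := n) θ (by positivity) hle
  have h2 := hn θ
  have h3 := hle θ
  have h4 : fejerFunctional n θ (truncation n f) - f θ
      = fejerFunctional n θ (truncation n (f - p)) + (fejerFunctional n θ (truncation n p) - p θ)
        - (f - p) θ := by
    conv_lhs => rw [← sub_add_cancel f p, truncation_add, map_add]
    simp only [ContinuousMap.add_apply, ContinuousMap.sub_apply]
    ring
  rw [h4]
  refine (norm_sub_le _ _).trans ?_
  linarith [norm_add_le (fejerFunctional n θ (truncation n (f - p)))
    (fejerFunctional n θ (truncation n p) - p θ)]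

/-! ### Translations -/

/-- The translate `x ↦ f (x - t)`. -/
noncomputable def translate (t : S1) (f : C(S1, ℂ)) : C(S1, ℂ) where
  toFun x := f (x - t)
  continuous_toFun := by fun_prop

lemma fourierCoeff_translate (t : S1) (f : C(S1, ℂ)) (k : ℤ) :
    fourierCoeff (translate t f) k = fourier (-k) t * fourierCoeff f k := by
  rw [fourierCoeff, fourierCoeff, ← MeasureTheory.integral_const_mul,
    ← MeasureTheory.integral_sub_right_eq_self (μ := AddCircle.haarAddCircle)
      (fun x : S1 => (fourier (-k) t : ℂ) * (fourier (-k) x • f x)) t]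
  refine MeasureTheory.integral_congr_ae (Eventually.of_forall fun x => ?_)
  change (fourier (-k) x : ℂ) • f (x - t) = fourier (-k) t * (fourier (-k) (x - t) • f (x - t))
  have h : (fourier (-k) x : ℂ) = fourier (-k) t * fourier (-k) (x - t) := by
    rw [fourier_apply, fourier_apply, fourier_apply, ← Circle.coe_mul, ← AddCircle.toCircle_add,
      ← zsmul_add, add_sub_cancel]
  rw [h, smul_eq_mul, smul_eq_mul, mul_assoc]

/-- Cesàro means commute with translations, so convergence for one wave controls all its translates
at once. -/
lemma fejerFunctional_translate (n : ℕ) (θ t : S1) (f : C(S1, ℂ)) :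
    fejerFunctional n θ (truncation n (translate t f))
      = fejerFunctional n (θ - t) (truncation n f) := by
  change (n : ℂ)⁻¹ * ∑ i : Fin n, ∑ j : Fin n,
      fourier ((i : ℤ) - j) θ * fourierCoeff (translate t f) ((i : ℤ) - j)
    = (n : ℂ)⁻¹ * ∑ i : Fin n, ∑ j : Fin n,
      fourier ((i : ℤ) - j) (θ - t) * fourierCoeff f ((i : ℤ) - j)
  congr 1
  refine Finset.sum_congr rfl fun i _ => Finset.sum_congr rfl fun j _ => ?_
  rw [fourierCoeff_translate, ← mul_assoc]
  congr 1
  rw [fourier_apply, fourier_apply, fourier_apply, ← Circle.coe_mul, ← AddCircle.toCircle_add,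
    neg_zsmul, zsmul_sub, sub_eq_add_neg (_ • θ)]

lemma translate_hasDerivAt {g g' : C(S1, ℂ)}
    (h : ∀ x : ℝ, HasDerivAt (fun y : ℝ => g (y : S1)) (g' (x : S1)) x) (t : S1) (x : ℝ) :
    HasDerivAt (fun y : ℝ => translate t g (y : S1)) (translate t g' (x : S1)) x := by
  obtain ⟨t, rfl⟩ := QuotientAddGroup.mk_surjective t
  exact (h (x - t)).comp_sub_const x t

/-! ### Gromov–Hausdorff convergence -/

/-- The wave centred at `t` is an admissible test element for every pair `s, t`. Each of the three
errors costs `ε / 3`: smoothing the triangle wave, and the Cesàro means at `s - t` and at `0`. -/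
lemma eventually_dist_le {ε : ℝ} (hε : 0 < ε) : ∀ᶠ n : ℕ+ in atTop, ∀ s t : S1,
    dist s t ≤ dist (fejerState n s) (fejerState n t) + ε := by
  obtain ⟨r, hr0, hr, H⟩ := exists_wave_approx (show 0 < ε / 3 by positivity)
  filter_upwards [fejerConverges (wave r) (ε / 3) (by positivity)] with n hn s t
  have h1 : lipNorm (truncation n (translate t (wave r))) ≤ 1 :=
    lipNorm_truncation_le (translate_hasDerivAt (hasDerivAt_wave hr0 hr) t)
      fun x => norm_waveDeriv_le hr0 hr _
  have h2 := le_connesDist (fejerState n s) (fejerState n t) h1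
  change ‖fejerFunctional n s _ - fejerFunctional n t _‖ ≤
    dist (fejerState n s) (fejerState n t) at h2
  rw [fejerFunctional_translate, fejerFunctional_translate, sub_self] at h2
  have h3 := H (s - t)
  have h4 := hn (s - t)
  have h5 := hn 0
  have h6 : wave r (s - t) - wave r 0
      = (fejerFunctional n (s - t) (truncation n (wave r)) - fejerFunctional n 0 (truncation n (wave r)))
        - (fejerFunctional n (s - t) (truncation n (wave r)) - wave r (s - t))
        + (fejerFunctional n 0 (truncation n (wave r)) - wave r 0) := by ring
  rw [h6] at h3
  have h7 := h3.trans (norm_add_le _ _)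
  have h8 := norm_sub_le
    (fejerFunctional n (s - t) (truncation n (wave r)) - fejerFunctional n 0 (truncation n (wave r)))
    (fejerFunctional n (s - t) (truncation n (wave r)) - wave r (s - t))
  rw [dist_eq_norm]
  linarith

lemma ghDist_fejerStates_le {n : ℕ} [NeZero n] {ε : ℝ}
    (h : ∀ s t : S1, dist s t ≤ dist (fejerState n s) (fejerState n t) + ε) :
    GromovHausdorff.ghDist (fejerStates n) S1 ≤ ε / 2 := by
  have hsymm : GromovHausdorff.ghDist (fejerStates n) S1
      = GromovHausdorff.ghDist S1 (fejerStates n) := dist_comm _ _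
  rw [hsymm]
  -- The bound obtained is `ε₁ + ε₂ / 2 + ε₃`. The map is defined on the whole circle and is onto,
  -- so `ε₁ = ε₃ = 0` and only the distortion `ε₂ = ε` counts.
  have := GromovHausdorff.ghDist_le_of_approx_subsets (X := S1) (Y := fejerStates n) (s := Set.univ)
    (ε₁ := 0) (ε₂ := ε) (ε₃ := 0)
    (fun s => ⟨fejerState n s, s, hasDensity_fejerState n s⟩)
    (fun x => ⟨x, Set.mem_univ x, (dist_self x).le⟩) ?_ ?_
  · linarith
  · rintro ⟨τ, θ, hθ⟩
    refine ⟨⟨θ, Set.mem_univ θ⟩, le_of_eq (dist_eq_zero.2 (Subtype.ext ?_))⟩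
    exact hθ.unique (hasDensity_fejerState n θ)
  · rintro ⟨s, -⟩ ⟨t, -⟩
    change |dist s t - dist (fejerState n s) (fejerState n t)| ≤ ε
    have h1 := h s t
    have h2 := dist_fejerState_le_dist n s t
    rw [abs_of_nonneg (by linarith)]
    linarith

theorem tendsto_ghDist_fejerStates :
    Tendsto (fun n : ℕ+ => GromovHausdorff.ghDist (fejerStates n) S1) atTop (𝓝 0) := by
  rw [Metric.tendsto_nhds]
  intro ε hε
  filter_upwards [eventually_dist_le hε] with n hn
  have h1 := ghDist_fejerStates_le hn
  have h2 : 0 ≤ GromovHausdorff.ghDist (fejerStates n) S1 := dist_nonneg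
  rw [Real.dist_eq, sub_zero, abs_of_nonneg h2]
  linarith

end ToeplitzCircle

theorem mainTheorem6 :
    (∀ n : ℕ+, fejerStates n ⊆ pureStates n) ∧
    (∀ s t : S1, IsLUB {r : ℝ | ∃ g : S1 → ℂ, ContDiff ℝ ∞ (fun x : ℝ => g x) ∧
      (∀ x : ℝ, ‖deriv (fun y : ℝ => g y) x‖ ≤ 1) ∧ r = ‖g s - g t‖} (dist s t)) ∧
    Tendsto (fun n : ℕ+ => GromovHausdorff.ghDist (fejerStates n) S1) atTop (𝓝 0) :=
  ⟨fun n => fejerStates_subset_pureStates n, isLUB_dist, tendsto_ghDist_fejerStates⟩
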